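/- Let $n\in\{1,2,\dots\}$, $p\in[1,\infty)$ and $K\in[0,\infty)$. For a nonnegative locally integrable function $\omega$ on $\mathbb{R}^n$ set $$[\omega]_{A_p}:=\sup_Q\Big(\frac1{|Q|}\int_Q\omega\,dx\Big)\Big(\frac1{|Q|}\int_Q\omega^{\frac1{1-p}}\,dx\Big)^{p-1}\ (p>1),\qquad [\omega]_{A_1}:=\sup_Q\Big(\frac1{|Q|}\int_Q\omega\,dx\Big)\,\|\omega^{-1}\|_{L^\infty(Q)},$$ where $Q$ runs over all cubes in $\mathbb{R}^n$ with sides parallel to the axes (negative powers of $0$ are $\infty$, and $0\cdot\infty=0$; the latter matters only for $\omega=0$ almost everywhere, when both sides of the claim vanish). We write $\omega\in A_p(\mathbb{R}^n)$ if $[\omega]_{A_p}<\infty$, and $\omega(S):=\int_S\omega\,dx$. Then there are constants $c,C\in(0,\infty)$, depending only on $n$, $p$ and $K$, such that, for every $\omega\in A_p(\mathbb{R}^n)$ with $[\omega]_{A_p}\le K$ and every twice continuously differentiable, compactly supported $f:\mathbb{R}^n\to\mathbb{C}$, $$c\int_{\mathbb{R}^n}|\nabla f(x)|^p\,\omega(x)\,dx\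 \le\ \sup_{\lambda\in(0,\infty)}\lambda^p\int_{\mathbb{R}^n}\int_{\mathbb{R}^n}\mathbf 1_{D_\lambda}(x,y)\,\omega(x)\,\omega(y)\,dx\,dy\ \le\ C\int_{\mathbb{R}^n}|\nabla f(x)|^p\,\omega(x)\,dx,$$ where $D_\lambda:=\{(x,y)\in\mathbb{R}^n\times\mathbb{R}^n:\ |f(x)-f(y)|>\lambda\,|x-y|\,[\omega(B(x,|x-y|))]^{1/p}\}$, $B(x,r)$ is the open Euclidean ball with center $x$ and radius $r$, and $|\nabla f|=(\sum_{i=1}^n|\partial_i f|^2)^{1/2}$. -/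

import Mathlib

open MeasureTheory
open scoped ENNReal NNReal

noncomputable section

/-- The cube in `ℝⁿ` with lowest corner `a`, side length `s` and sides parallel to the axes. -/
def cube {n : ℕ} (a : EuclideanSpace ℝ (Fin n)) (s : ℝ) : Set (EuclideanSpace ℝ (Fin n)) :=
  {x | ∀ i, x i ∈ Set.Icc (a i) (a i + s)}

/-- The Muckenhoupt constant `[ω]_{A_p}`, `1 ≤ p < ∞`, of a nonnegative function `ω` on `ℝⁿ`:
the supremum over all cubes `Q` of `(⨍_Q ω) (⨍_Q ω ^ (1 / (1 - p))) ^ (p - 1)` if `p > 1`, and of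
`(⨍_Q ω) ‖ω⁻¹‖_{L^∞(Q)}` if `p = 1`. The values are in `[0, ∞]`, with `0⁻¹ = ∞`. -/
def apConst {n : ℕ} (p : ℝ) (ω : EuclideanSpace ℝ (Fin n) → ℝ) : ℝ≥0∞ :=
  if p = 1 then
    ⨆ (a : EuclideanSpace ℝ (Fin n)) (s : ℝ) (_ : 0 < s),
      (⨍⁻ x in cube a s, ENNReal.ofReal (ω x) ∂volume) *
        essSup (fun x => (ENNReal.ofReal (ω x))⁻¹) (volume.restrict (cube a s))
  else
    ⨆ (a : EuclideanSpace ℝ (Fin n)) (s : ℝ) (_ : 0 < s),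
      (⨍⁻ x in cube a s, ENNReal.ofReal (ω x) ∂volume) *
        (⨍⁻ x in cube a s, (ENNReal.ofReal (ω x)) ^ (1 / (1 - p)) ∂volume) ^ (p - 1)

/-- `ω ∈ A_p(ℝⁿ)`. -/
structure IsApWeight {n : ℕ} (p : ℝ) (ω : EuclideanSpace ℝ (Fin n) → ℝ) : Prop where
  nonneg : ∀ x, 0 ≤ ω x
  locallyIntegrable : LocallyIntegrable ω volume
  apConst_lt_top : apConst p ω < ∞

/-- `ω(S) = ∫_S ω(x) dx`, with values in `[0, ∞]`. -/
def weightOf {n : ℕ} (ω : EuclideanSpace ℝ (Fin n) → ℝ) (S : Set (EuclideanSpace ℝ (Fin n))) :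
    ℝ≥0∞ :=
  ∫⁻ x in S, ENNReal.ofReal (ω x)

/-- The Euclidean length `|∇f(x)| = (∑ᵢ |∂ᵢf(x)|²) ^ (1/2)` of the gradient of `f`. -/
def gradNorm {n : ℕ} (f : EuclideanSpace ℝ (Fin n) → ℂ) (x : EuclideanSpace ℝ (Fin n)) : ℝ :=
  √(∑ i, ‖fderiv ℝ f x (EuclideanSpace.single i 1)‖ ^ 2)

/-- The set of all `(x, y)` with `|f(x) - f(y)| > t |x - y| ω(B(x, |x - y|)) ^ (1/p)`. -/
def superlevelSet {n : ℕ} (p : ℝ) (ω : EuclideanSpace ℝ (Fin n) → ℝ)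
    (f : EuclideanSpace ℝ (Fin n) → ℂ) (t : ℝ) :
    Set (EuclideanSpace ℝ (Fin n) × EuclideanSpace ℝ (Fin n)) :=
  {z | ENNReal.ofReal (t * ‖z.1 - z.2‖) * weightOf ω (Metric.ball z.1 ‖z.1 - z.2‖) ^ (1 / p) <
    ENNReal.ofReal ‖f z.1 - f z.2‖}

/-- `sup_{t > 0} t ^ p ∬ 1_{D_t}(x, y) ω(x) ω(y) dx dy`, where `D_t` is `superlevelSet p ω f t`. -/
def weakQuasinormPow {n : ℕ} (p : ℝ) (ω : EuclideanSpace ℝ (Fin n) → ℝ)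
    (f : EuclideanSpace ℝ (Fin n) → ℂ) : ℝ≥0∞ :=
  ⨆ (t : ℝ) (_ : 0 < t), ENNReal.ofReal (t ^ p) *
    ∫⁻ y, ∫⁻ x, (superlevelSet p ω f t).indicator 1 (x, y) *
      ENNReal.ofReal (ω x) * ENNReal.ofReal (ω y)

/-- `∫ |∇f(x)| ^ p ω(x) dx`. -/
def sobolevPow {n : ℕ} (p : ℝ) (ω : EuclideanSpace ℝ (Fin n) → ℝ)
    (f : EuclideanSpace ℝ (Fin n) → ℂ) : ℝ≥0∞ :=
  ∫⁻ x, ENNReal.ofReal (gradNorm f x ^ p * ω x)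

end

/-! ### Muckenhoupt's condition: from cubes to balls, and doubling. -/

section Muckenhoupt

variable {n : ℕ}

/-! Everything is proved for the measure `μ = ω dx`, and the weight enters the estimates through
`BallAp`, which contains doubling (`BallAp.measure_ball_le`).

Upper bound: let `(x, y)` lie in the level set and put `r = |x - y|`. Averaging `f` over a ball
around the midpoint and integrating `∇f` along segments gives a ball `B(c, s)`, with `c = x` or `c =
y` and `s ≤ r`, on which the average of `|∇f|` exceeds a multiple of `(r / s) ^ (1/2) * t * μ(B(x,
r)) ^ (1/p)` (`exists_ball_average_gradNorm_gt`). By the `A_p` condition, the energy on `B(c, s)`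
then dominates `t ^ p * 2 ^ (j/2) * μ(B(c, s)) * μ(B(c, 2 ^ j s))`, where `2 ^ j` is comparable to
`r / s` (`exists_ball_energy_ge`). For fixed `j`, a Vitali covering bounds the product measure of
such pairs (`prod_measure_vitali_le`), and the gain `2 ^ (j/2)` makes the sum over `j` a convergent
geometric series.

Lower bound: if `∇f(x) ≠ 0` and `k` is large, choose a small `r` at which `μ(B(x, r))` is about
`(|∇f(x)| / k) ^ p`. A ball in `B(x, r)` of comparable radius lies in the section at `x` of the
level set for `t = k`, so `k ^ p` times the `μ`-measure of that section is at least a multiple of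
`|∇f(x)| ^ p` (`eventually_gradNorm_rpow_le`). Fatou's lemma integrates this over `x`. -/

/-- The `A_p` condition for a measure `μ` on `ℝⁿ`, tested on balls: the `p`-th power of the Lebesgue
average of `g` over a ball is at most `A` times the `μ`-average of `g ^ p`. -/
def BallAp (p : ℝ) (A : ℝ≥0) (μ : Measure (EuclideanSpace ℝ (Fin n))) : Prop :=
  ∀ (x : EuclideanSpace ℝ (Fin n)) (r : ℝ), 0 < r →
    ∀ g : EuclideanSpace ℝ (Fin n) → ℝ≥0∞, Measurable g →
      (∫⁻ z in Metric.ball x r, g z) ^ p * μ (Metric.ball x r) ≤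
        A * volume (Metric.ball x r) ^ p * ∫⁻ z in Metric.ball x r, g z ^ p ∂μ

lemma volume_cube (a : EuclideanSpace ℝ (Fin n)) (s : ℝ) :
    volume (cube a s) = ENNReal.ofReal s ^ n := by
  have h : cube a s = (WithLp.ofLp : EuclideanSpace ℝ (Fin n) → Fin n → ℝ) ⁻¹'
      (Set.Icc (fun i => a i) (fun i => a i + s)) := by
    ext x
    simp [cube, Set.mem_Icc, Pi.le_def, forall_and]
  rw [h, (PiLp.volume_preserving_ofLp (Fin n)).measure_preimage
    measurableSet_Icc.nullMeasurableSet, Real.volume_Icc_pi]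
  simp

lemma ball_subset_cube (x : EuclideanSpace ℝ (Fin n)) (r : ℝ) :
    Metric.ball x r ⊆ cube (WithLp.toLp 2 fun i => x i - r) (2 * r) := by
  intro z hz i
  have h1 : |z i - x i| < r := by
    have := PiLp.norm_apply_le (z - x) i
    rw [Metric.mem_ball, dist_eq_norm] at hz
    simpa using this.trans_lt hz
  rw [abs_lt] at h1
  constructor <;> simp <;> linarith

/-- Hölder's inequality on a set where the weight may vanish only if it vanishes identically. -/
lemma lintegral_rpow_mul_le_of_one_lt {α : Type*} [MeasurableSpace α] {ν : Measure α} {p : ℝ}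
    (hp : 1 < p) {w g : α → ℝ≥0∞} (hw : AEMeasurable w ν) (hwtop : ∀ x, w x ≠ ∞)
    (hg : AEMeasurable g ν) {B : ℝ≥0∞} (hB : B ≠ ∞)
    (hAp : (∫⁻ x, w x ∂ν) * (∫⁻ x, w x ^ (1 / (1 - p)) ∂ν) ^ (p - 1) ≤ B) :
    (∫⁻ x, g x ∂ν) ^ p * ∫⁻ x, w x ∂ν ≤ B * ∫⁻ x, g x ^ p * w x ∂ν := by
  rcases eq_or_ne (∫⁻ x, w x ∂ν) 0 with h0 | h0
  · simp [h0]
  -- Finiteness of the dual integral forces `w > 0` almost everywhere, so Hölder can be applied to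
  -- `g = (g w ^ (1/p)) * w ^ (-1/p)`.
  have hS : (∫⁻ x, w x ^ (1 / (1 - p)) ∂ν) ≠ ∞ := by
    intro h
    rw [h, ENNReal.top_rpow_of_pos (by linarith), ENNReal.mul_top h0] at hAp
    exact hB (top_le_iff.1 hAp)
  have hneg : 1 / (1 - p) < 0 := one_div_neg.2 (by linarith)
  have hpos : ∀ᵐ x ∂ν, w x ≠ 0 := by
    filter_upwards [ae_lt_top' (hw.pow_const _) hS] with x hx h
    rw [h, ENNReal.zero_rpow_of_neg hneg] at hx
    exact lt_irrefl _ hx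
  have hpq : p.HolderConjugate (p / (p - 1)) := Real.HolderConjugate.conjExponent hp
  have hol := ENNReal.lintegral_mul_le_Lp_mul_Lq ν hpq
    (hg.mul (hw.pow_const (1 / p))) (hw.pow_const (-(1 / p)))
  have e1 : ∫⁻ x, ((fun x => g x * w x ^ (1 / p)) * fun x => w x ^ (-(1 / p))) x ∂ν
      = ∫⁻ x, g x ∂ν := by
    refine lintegral_congr_ae ?_
    filter_upwards [hpos] with x hx
    simp only [Pi.mul_apply]
    rw [mul_assoc, ← ENNReal.rpow_add _ _ hx (hwtop x)]
    simp
  have e2 : ∫⁻ x, (g x * w x ^ (1 / p)) ^ p ∂ν = ∫⁻ x, g x ^ p * w x ∂ν := by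
    refine lintegral_congr fun x => ?_
    rw [ENNReal.mul_rpow_of_nonneg _ _ (by linarith), ← ENNReal.rpow_mul,
      one_div_mul_cancel (by linarith), ENNReal.rpow_one]
  have e3 : ∫⁻ x, (w x ^ (-(1 / p))) ^ (p / (p - 1)) ∂ν = ∫⁻ x, w x ^ (1 / (1 - p)) ∂ν := by
    refine lintegral_congr fun x => ?_
    rw [← ENNReal.rpow_mul]
    congr 1
    have : p - 1 ≠ 0 := by linarith
    have : 1 - p ≠ 0 := by linarith
    have : p ≠ 0 := by linarith
    field_simp
    ring
  simp only [Pi.mul_apply] at hol e1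
  rw [e1, e2, e3] at hol
  have hol2 := ENNReal.rpow_le_rpow hol (by linarith : 0 ≤ p)
  rw [ENNReal.mul_rpow_of_nonneg _ _ (by linarith), ← ENNReal.rpow_mul,
    one_div_mul_cancel (by linarith), ENNReal.rpow_one, ← ENNReal.rpow_mul,
    show 1 / (p / (p - 1)) * p = p - 1 by
      have : p ≠ 0 := by linarith
      field_simp] at hol2
  calc _ ≤ ((∫⁻ x, g x ^ p * w x ∂ν) * (∫⁻ x, w x ^ (1 / (1 - p)) ∂ν) ^ (p - 1)) *
        ∫⁻ x, w x ∂ν := by gcongr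
    _ = ((∫⁻ x, w x ∂ν) * (∫⁻ x, w x ^ (1 / (1 - p)) ∂ν) ^ (p - 1)) *
        ∫⁻ x, g x ^ p * w x ∂ν := by ring
    _ ≤ _ := by gcongr

/-- The endpoint `p = 1`: with `M` the essential supremum of `w⁻¹`, one has `1 ≤ M w` almost
everywhere, and this factor is inserted into the integral of `g`. -/
lemma lintegral_mul_le_of_essSup_inv {α : Type*} [MeasurableSpace α] {ν : Measure α}
    {w g : α → ℝ≥0∞} (hwtop : ∀ x, w x ≠ ∞) {B : ℝ≥0∞} (hB : B ≠ ∞)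
    (hAp : (∫⁻ x, w x ∂ν) * essSup (fun x => (w x)⁻¹) ν ≤ B) :
    (∫⁻ x, g x ∂ν) * ∫⁻ x, w x ∂ν ≤ B * ∫⁻ x, g x * w x ∂ν := by
  rcases eq_or_ne (∫⁻ x, w x ∂ν) 0 with h0 | h0
  · simp [h0]
  set M := essSup (fun x => (w x)⁻¹) ν with hM
  have hMtop : M ≠ ∞ := by
    intro h
    rw [h, ENNReal.mul_top h0] at hAp
    exact hB (top_le_iff.1 hAp)
  have h1 : ∀ᵐ x ∂ν, 1 ≤ M * w x := by
    filter_upwards [ENNReal.ae_le_essSup (fun x => (w x)⁻¹)] with x hx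
    have hx0 : w x ≠ 0 := by
      intro h
      rw [h, ENNReal.inv_zero] at hx
      exact hMtop (top_le_iff.1 hx)
    calc (1 : ℝ≥0∞) = (w x)⁻¹ * w x := (ENNReal.inv_mul_cancel hx0 (hwtop x)).symm
      _ ≤ _ := by gcongr
  calc _ ≤ (∫⁻ x, M * (g x * w x) ∂ν) * ∫⁻ x, w x ∂ν := by
        gcongr ?_ * _
        refine lintegral_mono_ae ?_
        filter_upwards [h1] with x hx
        calc g x = g x * 1 := (mul_one _).symm
          _ ≤ g x * (M * w x) := by gcongr
          _ = _ := by ring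
    _ = ((∫⁻ x, w x ∂ν) * M) * ∫⁻ x, g x * w x ∂ν := by
        rw [lintegral_const_mul' _ _ hMtop]; ring
    _ ≤ _ := by gcongr

lemma volume_cube_pos (a : EuclideanSpace ℝ (Fin n)) {s : ℝ} (hs : 0 < s) :
    volume (cube a s) ≠ 0 := by
  rw [volume_cube]
  exact pow_ne_zero _ (ENNReal.ofReal_pos.2 hs).ne'

lemma volume_cube_ne_top (a : EuclideanSpace ℝ (Fin n)) (s : ℝ) : volume (cube a s) ≠ ∞ := by
  rw [volume_cube]
  exact ENNReal.pow_ne_top ENNReal.ofReal_ne_top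

/-- The `A_p` condition on cubes, tested against a function. -/
lemma cube_lintegral_rpow_mul_le {p : ℝ} (hp : 1 ≤ p) {K : ℝ≥0}
    {ω : EuclideanSpace ℝ (Fin n) → ℝ} (hω : AEMeasurable (fun x => ENNReal.ofReal (ω x)) volume)
    (hK : apConst p ω ≤ K) (a : EuclideanSpace ℝ (Fin n)) {s : ℝ} (hs : 0 < s)
    {g : EuclideanSpace ℝ (Fin n) → ℝ≥0∞} (hg : Measurable g) :
    (∫⁻ x in cube a s, g x) ^ p * ∫⁻ x in cube a s, ENNReal.ofReal (ω x) ≤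
      K * volume (cube a s) ^ p * ∫⁻ x in cube a s, g x ^ p * ENNReal.ofReal (ω x) := by
  have hV0 := volume_cube_pos a hs
  have hVt := volume_cube_ne_top a s
  have hB : K * volume (cube a s) ^ p ≠ ∞ :=
    ENNReal.mul_ne_top ENNReal.coe_ne_top (ENNReal.rpow_ne_top_of_nonneg (by linarith) hVt)
  rcases hp.eq_or_lt with rfl | hp1
  · have h : (⨍⁻ x in cube a s, ENNReal.ofReal (ω x) ∂volume) *
        essSup (fun x => (ENNReal.ofReal (ω x))⁻¹) (volume.restrict (cube a s)) ≤ K := by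
      refine le_trans ?_ hK
      rw [apConst, if_pos rfl]
      exact le_iSup_of_le a (le_iSup_of_le s (le_iSup_of_le hs le_rfl))
    have := lintegral_mul_le_of_essSup_inv (ν := volume.restrict (cube a s)) (g := g)
      (fun x => ENNReal.ofReal_ne_top) hB (w := fun x => ENNReal.ofReal (ω x)) (by
        rw [ENNReal.rpow_one, ← ENNReal.div_le_iff_le_mul (Or.inl hV0) (Or.inl hVt)]
        rw [setLAverage_eq] at h
        convert h using 1
        simp only [div_eq_mul_inv]; ring)
    simpa using this
  · have h : (⨍⁻ x in cube a s, ENNReal.ofReal (ω x) ∂volume) *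
        (⨍⁻ x in cube a s, (ENNReal.ofReal (ω x)) ^ (1 / (1 - p)) ∂volume) ^ (p - 1) ≤ K := by
      refine le_trans ?_ hK
      rw [apConst, if_neg hp1.ne']
      exact le_iSup_of_le a (le_iSup_of_le s (le_iSup_of_le hs le_rfl))
    refine lintegral_rpow_mul_le_of_one_lt hp1 hω.restrict (fun x => ENNReal.ofReal_ne_top)
      hg.aemeasurable hB ?_
    have hVp0 : volume (cube a s) ^ p ≠ 0 := (ENNReal.rpow_pos hV0.bot_lt hVt).ne'
    have hVpt : volume (cube a s) ^ p ≠ ∞ := ENNReal.rpow_ne_top_of_nonneg (by linarith) hVt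
    rw [← ENNReal.div_le_iff_le_mul (Or.inl hVp0) (Or.inl hVpt)]
    rw [setLAverage_eq, setLAverage_eq, ENNReal.div_rpow_of_nonneg _ _ (by linarith)] at h
    convert h using 1
    have : volume (cube a s) ^ p = volume (cube a s) * volume (cube a s) ^ (p - 1) := by
      conv_lhs => rw [show p = 1 + (p - 1) by ring]
      rw [ENNReal.rpow_add _ _ hV0 hVt, ENNReal.rpow_one]
    rw [this]
    simp only [div_eq_mul_inv]
    rw [ENNReal.mul_inv (Or.inl hV0) (Or.inl hVt)]
    ring

/-- The cube condition is tested on the circumscribed cube of a ball with `g` cut off to the ball.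
The price is the `p`-th power of the volume ratio `2 ^ n / v`. The summand `1` in the witness only
makes `A` positive. -/
lemma exists_ballAp (n : ℕ) {p : ℝ} (hp : 1 ≤ p) (K : ℝ≥0) :
    ∃ A : ℝ≥0, 0 < A ∧ ∀ ω : EuclideanSpace ℝ (Fin n) → ℝ,
      AEMeasurable (fun x => ENNReal.ofReal (ω x)) volume → apConst p ω ≤ K →
        BallAp p A (volume.withDensity fun x => ENNReal.ofReal (ω x)) := by
  set v := volume (Metric.ball (0 : EuclideanSpace ℝ (Fin n)) 1) with hv
  have hv0 : v ≠ 0 := (Metric.measure_ball_pos volume _ one_pos).ne'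
  have hvt : v ≠ ∞ := measure_ball_lt_top.ne
  have hp0 : 0 ≤ p := by linarith
  have hc : (2 ^ n / v) ^ p ≠ ∞ := ENNReal.rpow_ne_top_of_nonneg hp0
    (ENNReal.div_ne_top (by simp) hv0)
  refine ⟨(K * (2 ^ n / v) ^ p).toNNReal + 1, by positivity, fun ω hω hK x r hr g hg => ?_⟩
  have hA : (K * (2 ^ n / v) ^ p : ℝ≥0∞) ≤ ((K * (2 ^ n / v) ^ p).toNNReal + 1 : ℝ≥0) := by
    rw [ENNReal.coe_add, ENNReal.coe_toNNReal (ENNReal.mul_ne_top ENNReal.coe_ne_top hc)]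
    exact le_self_add
  set Q := cube (WithLp.toLp 2 fun i => x i - r) (2 * r)
  have hBQ : Metric.ball x r ⊆ Q := ball_subset_cube x r
  have hVQ : volume Q = 2 ^ n / v * volume (Metric.ball x r) := by
    rw [volume_cube, Measure.addHaar_ball_of_pos _ _ hr, ← hv, finrank_euclideanSpace_fin,
      ENNReal.ofReal_mul zero_le_two, mul_pow, ENNReal.ofReal_pow hr.le, mul_left_comm,
      ENNReal.div_mul_cancel hv0 hvt, mul_comm]
    simp
  have hind : Measurable ((Metric.ball x r).indicator g) := hg.indicator measurableSet_ball
  have key := cube_lintegral_rpow_mul_le hp hω hK (WithLp.toLp 2 fun i => x i - r)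
    (by positivity : 0 < 2 * r) hind
  change _ ≤ _ * volume Q ^ p * _ at key
  have e1 : ∫⁻ z in Q, (Metric.ball x r).indicator g z = ∫⁻ z in Metric.ball x r, g z := by
    rw [setLIntegral_indicator measurableSet_ball, Set.inter_eq_left.2 hBQ]
  have e2 : ∫⁻ z in Q, (Metric.ball x r).indicator g z ^ p * ENNReal.ofReal (ω z) =
      ∫⁻ z in Metric.ball x r, g z ^ p ∂(volume.withDensity fun x => ENNReal.ofReal (ω x)) := by
    rw [restrict_withDensity measurableSet_ball,
      lintegral_withDensity_eq_lintegral_mul₀ hω.restrict (hg.pow_const p).aemeasurable,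
      ← Set.inter_eq_left.2 hBQ, ← setLIntegral_indicator measurableSet_ball]
    refine lintegral_congr fun z => ?_
    by_cases hz : z ∈ Metric.ball x r
    · simp [hz, hBQ hz, mul_comm]
    · simp [hz, ENNReal.zero_rpow_of_pos (by linarith : 0 < p)]
  rw [e1, e2, hVQ, ENNReal.mul_rpow_of_nonneg _ _ hp0] at key
  calc _ ≤ (∫⁻ z in Metric.ball x r, g z) ^ p * ∫⁻ x in Q, ENNReal.ofReal (ω x) := by
        rw [withDensity_apply _ measurableSet_ball]
        gcongr
    _ ≤ _ := key
    _ = (K * (2 ^ n / v) ^ p) * volume (Metric.ball x r) ^ p *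
        ∫⁻ z in Metric.ball x r, g z ^ p ∂(volume.withDensity fun x => ENNReal.ofReal (ω x)) := by
      ring
    _ ≤ _ := by gcongr

/-- Comparison of the `μ`-measures of a ball and of a ball contained in it. -/
lemma BallAp.measure_ball_le {p : ℝ} (hp : 1 ≤ p) {A : ℝ≥0}
    {μ : Measure (EuclideanSpace ℝ (Fin n))} (h : BallAp p A μ)
    {x y : EuclideanSpace ℝ (Fin n)} {s m : ℝ} (hs : 0 < s) (hm : 0 < m)
    (hsub : Metric.ball y s ⊆ Metric.ball x (m * s)) :
    μ (Metric.ball x (m * s)) ≤ A * ENNReal.ofReal (m ^ n) ^ p * μ (Metric.ball y s) := by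
  have hp0 : 0 ≤ p := by linarith
  -- With the indicator of the inner ball as test function, the Lebesgue volumes cancel up to the
  -- ratio `m ^ n`.
  have key := h x (m * s) (by positivity) ((Metric.ball y s).indicator 1)
    (measurable_one.indicator measurableSet_ball)
  have e : ∀ ν : Measure (EuclideanSpace ℝ (Fin n)),
      ∫⁻ z in Metric.ball x (m * s), (Metric.ball y s).indicator 1 z ∂ν = ν (Metric.ball y s) := by
    intro ν
    rw [setLIntegral_indicator measurableSet_ball, Set.inter_eq_left.2 hsub]
    simp
  have e' : ∀ z, ((Metric.ball y s).indicator 1 z : ℝ≥0∞) ^ p = (Metric.ball y s).indicator 1 z := by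
    intro z
    by_cases hz : z ∈ Metric.ball y s
    · simp [hz]
    · simp [hz, ENNReal.zero_rpow_of_pos (by linarith : 0 < p)]
  simp_rw [e'] at key
  rw [e, e] at key
  have hV : volume (Metric.ball x (m * s)) = ENNReal.ofReal (m ^ n) * volume (Metric.ball y s) := by
    rw [Measure.addHaar_ball_mul_of_pos _ _ hm, finrank_euclideanSpace_fin,
      Measure.addHaar_ball_center _ y]
  have hV0 : volume (Metric.ball y s) ≠ 0 := (Metric.measure_ball_pos volume _ hs).ne'
  have hVt : volume (Metric.ball y s) ≠ ∞ := measure_ball_lt_top.ne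
  have hVp0 : volume (Metric.ball y s) ^ p ≠ 0 := (ENNReal.rpow_pos hV0.bot_lt hVt).ne'
  have hVpt : volume (Metric.ball y s) ^ p ≠ ∞ := ENNReal.rpow_ne_top_of_nonneg hp0 hVt
  rw [hV, ENNReal.mul_rpow_of_nonneg _ _ hp0] at key
  rw [← ENNReal.mul_le_mul_iff_right hVp0 hVpt]
  refine key.trans_eq ?_
  ring

end Muckenhoupt

/-! ### The upper bound: segments, dyadic scales and a Vitali covering. -/

section UpperBound

variable {n : ℕ}

lemma gradNorm_nonneg (f : EuclideanSpace ℝ (Fin n) → ℂ) (x : EuclideanSpace ℝ (Fin n)) :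
    0 ≤ gradNorm f x := Real.sqrt_nonneg _

lemma norm_fderiv_apply_le (f : EuclideanSpace ℝ (Fin n) → ℂ) (x v : EuclideanSpace ℝ (Fin n)) :
    ‖fderiv ℝ f x v‖ ≤ gradNorm f x * ‖v‖ := by
  have hv : v = ∑ i, v i • EuclideanSpace.single i (1 : ℝ) := by
    ext j
    simp [Finset.sum_apply, Pi.single_apply]
  calc ‖fderiv ℝ f x v‖ = ‖∑ i, v i • fderiv ℝ f x (EuclideanSpace.single i 1)‖ := by
        conv_lhs => rw [hv]
        simp
    _ ≤ ∑ i, ‖fderiv ℝ f x (EuclideanSpace.single i 1)‖ * ‖v i‖ := by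
        refine (norm_sum_le _ _).trans (Finset.sum_le_sum fun i _ => ?_)
        rw [norm_smul, mul_comm]
    _ ≤ √(∑ i, ‖fderiv ℝ f x (EuclideanSpace.single i 1)‖ ^ 2) * √(∑ i, ‖v i‖ ^ 2) :=
        Real.sum_mul_le_sqrt_mul_sqrt _ _ _
    _ = _ := by rw [gradNorm, EuclideanSpace.norm_eq]

lemma continuous_gradNorm {f : EuclideanSpace ℝ (Fin n) → ℂ} (hf : ContDiff ℝ 1 f) :
    Continuous (gradNorm f) := by
  unfold gradNorm
  have := hf.continuous_fderiv one_ne_zero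
  fun_prop

lemma enorm_sub_le_lintegral_gradNorm {f : EuclideanSpace ℝ (Fin n) → ℂ} (hf : ContDiff ℝ 1 f)
    (x v : EuclideanSpace ℝ (Fin n)) :
    ‖f (x + v) - f x‖ₑ ≤
      ∫⁻ t in Set.Ioc (0 : ℝ) 1, ENNReal.ofReal (gradNorm f (x + t • v)) * ‖v‖ₑ := by
  have hd : ∀ t ∈ Set.uIcc (0 : ℝ) 1,
      HasDerivAt (fun t : ℝ => f (x + t • v)) (fderiv ℝ f (x + t • v) v) t := by
    intro t _
    have h1 : HasDerivAt (fun t : ℝ => x + t • v) v t := by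
      simpa using ((hasDerivAt_id t).smul_const v).const_add x
    exact ((hf.differentiable one_ne_zero (x + t • v)).hasFDerivAt).comp_hasDerivAt t h1
  have hc : Continuous fun t : ℝ => fderiv ℝ f (x + t • v) v := by
    have := hf.continuous_fderiv one_ne_zero
    fun_prop
  have := intervalIntegral.integral_eq_sub_of_hasDerivAt hd (hc.intervalIntegrable 0 1)
  simp only [one_smul, zero_smul, add_zero] at this
  rw [← this, intervalIntegral.integral_of_le zero_le_one]
  refine (enorm_integral_le_lintegral_enorm _).trans (lintegral_mono fun t => ?_)
  rw [← ofReal_norm, ← ofReal_norm, ← ENNReal.ofReal_mul (gradNorm_nonneg _ _)]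
  exact ENNReal.ofReal_le_ofReal (norm_fderiv_apply_le _ _ _)

/-- The substitution `z = x + t v` turns an integral over endpoints of segments, at fixed time `t`,
into an integral over the ball of radius `t r`. -/
lemma lintegral_ball_comp_homothety {G : EuclideanSpace ℝ (Fin n) → ℝ≥0∞} (hG : Measurable G)
    (x : EuclideanSpace ℝ (Fin n)) (r : ℝ) {t : ℝ} (ht : 0 < t) :
    ENNReal.ofReal (t ^ n) * ∫⁻ v in Metric.ball 0 r, G (x + t • v) =
      ∫⁻ z in Metric.ball x (t * r), G z := by
  set H : EuclideanSpace ℝ (Fin n) → ℝ≥0∞ :=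
    fun w => (Metric.ball x (t * r)).indicator G (x + w) with hH
  have hHm : Measurable H := (hG.indicator measurableSet_ball).comp (measurable_const_add x)
  have h1 : ∫⁻ v in Metric.ball 0 r, G (x + t • v) = ∫⁻ v, H (t • v) := by
    rw [← lintegral_indicator measurableSet_ball]
    refine lintegral_congr fun v => ?_
    have : v ∈ Metric.ball (0 : EuclideanSpace ℝ (Fin n)) r ↔ x + t • v ∈ Metric.ball x (t * r) := by
      simp [norm_smul, abs_of_pos ht, ht]
    by_cases hv : v ∈ Metric.ball (0 : EuclideanSpace ℝ (Fin n)) r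
    · rw [Set.indicator_of_mem hv, hH]
      simp only
      rw [Set.indicator_of_mem (this.1 hv)]
    · rw [Set.indicator_of_notMem hv, hH]
      simp only
      rw [Set.indicator_of_notMem (fun h => hv (this.2 h))]
  have h2 : ∫⁻ v, H (t • v) = ENNReal.ofReal (t ^ n)⁻¹ * ∫⁻ w, H w := by
    rw [← lintegral_map hHm (measurable_const_smul t), Measure.map_addHaar_smul _ ht.ne',
      lintegral_smul_measure, finrank_euclideanSpace_fin, abs_of_pos (by positivity)]
    rfl
  have h3 : ∫⁻ w, H w = ∫⁻ z in Metric.ball x (t * r), G z := by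
    rw [hH, lintegral_add_left_eq_self (fun z => (Metric.ball x (t * r)).indicator G z) x,
      lintegral_indicator measurableSet_ball]
  rw [h1, h2, h3, ← mul_assoc, ← ENNReal.ofReal_mul (by positivity),
    mul_inv_cancel₀ (by positivity), ENNReal.ofReal_one, one_mul]

lemma lintegral_Ioc_inv_rpow_half :
    ∫⁻ t in Set.Ioc (0 : ℝ) 1, ENNReal.ofReal (t⁻¹ ^ (1 / 2 : ℝ)) = 2 := by
  have h1 : ∀ t ∈ Set.Ioc (0 : ℝ) 1,
      ENNReal.ofReal (t⁻¹ ^ (1 / 2 : ℝ)) = ENNReal.ofReal (t ^ (-(1 / 2) : ℝ)) := by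
    intro t ht
    rw [Real.rpow_neg ht.1.le, Real.inv_rpow ht.1.le]
  rw [setLIntegral_congr_fun measurableSet_Ioc h1, ← ofReal_integral_eq_lintegral_ofReal]
  · rw [← intervalIntegral.integral_of_le zero_le_one, integral_rpow (Or.inl (by norm_num))]
    norm_num
  · have := intervalIntegral.intervalIntegrable_rpow' (a := 0) (b := 1)
      (by norm_num : (-1 : ℝ) < -(1 / 2))
    rwa [intervalIntegrable_iff_integrableOn_Ioc_of_le zero_le_one] at this
  · filter_upwards [ae_restrict_mem measurableSet_Ioc] with t ht
    exact Real.rpow_nonneg ht.1.le _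

/-- If the averages of `|∇f|` over the balls `B(x, s)`, `s ≤ r`, grow at most like `s ^ (-1/2)`,
then the mean oscillation of `f` about `f x` on `B(x, r)` is controlled. -/
lemma lintegral_ball_enorm_sub_le {f : EuclideanSpace ℝ (Fin n) → ℂ} (hf : ContDiff ℝ 1 f)
    (x : EuclideanSpace ℝ (Fin n)) {r : ℝ} (hr : 0 < r) {M : ℝ≥0∞}
    (h : ∀ s, 0 < s → s ≤ r → ∫⁻ z in Metric.ball x s, ENNReal.ofReal (gradNorm f z) ≤
      M * ENNReal.ofReal ((r / s) ^ (1 / 2 : ℝ)) * volume (Metric.ball x s)) :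
    ∫⁻ z in Metric.ball x r, ‖f z - f x‖ₑ ≤
      2 * ENNReal.ofReal r * M * volume (Metric.ball x r) := by
  set G : EuclideanSpace ℝ (Fin n) → ℝ≥0∞ := fun z => ENNReal.ofReal (gradNorm f z) with hGdef
  have hGc : Continuous G := ENNReal.continuous_ofReal.comp (continuous_gradNorm hf)
  have e0 := lintegral_ball_comp_homothety (G := fun z => ‖f z - f x‖ₑ)
    (by have := hf.continuous; fun_prop) x r one_pos
  simp only [one_pow, ENNReal.ofReal_one, one_mul, one_smul] at e0
  rw [← e0]
  have hjoint : Measurable (Function.uncurry fun (v : EuclideanSpace ℝ (Fin n)) (t : ℝ) =>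
      G (x + t • v)) := by
    have : Continuous (Function.uncurry fun (v : EuclideanSpace ℝ (Fin n)) (t : ℝ) =>
      G (x + t • v)) := hGc.comp (by fun_prop)
    exact this.measurable
  calc ∫⁻ v in Metric.ball 0 r, ‖f (x + v) - f x‖ₑ
      ≤ ∫⁻ v in Metric.ball 0 r, ∫⁻ t in Set.Ioc (0 : ℝ) 1, G (x + t • v) * ENNReal.ofReal r := by
        refine setLIntegral_mono' measurableSet_ball fun v hv => ?_
        refine (enorm_sub_le_lintegral_gradNorm hf x v).trans (lintegral_mono fun t => ?_)
        gcongr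
        rw [← ofReal_norm]
        exact ENNReal.ofReal_le_ofReal (mem_ball_zero_iff.1 hv).le
    _ = ∫⁻ t in Set.Ioc (0 : ℝ) 1, ∫⁻ v in Metric.ball 0 r, G (x + t • v) * ENNReal.ofReal r :=
        lintegral_lintegral_swap (hjoint.mul_const _).aemeasurable
    _ ≤ ∫⁻ t in Set.Ioc (0 : ℝ) 1, ENNReal.ofReal (t⁻¹ ^ (1 / 2 : ℝ)) *
          (ENNReal.ofReal r * M * volume (Metric.ball x r)) := by
        refine setLIntegral_mono' measurableSet_Ioc fun t ht => ?_
        have ht0 : 0 < t := ht.1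
        -- The hypothesis at radius `s = t r` costs the factor `t ^ (-1/2)`, whose integral over
        -- `(0, 1]` is `2`.
        rw [lintegral_mul_const' _ _ ENNReal.ofReal_ne_top]
        have h1 := lintegral_ball_comp_homothety hGc.measurable x r ht0
        have h2 := h (t * r) (by positivity) (by nlinarith [ht.2])
        rw [← h1, show r / (t * r) = t⁻¹ by field_simp, Measure.addHaar_ball_mul_of_pos _ _ ht0,
          finrank_euclideanSpace_fin] at h2
        have hV0 : ENNReal.ofReal (t ^ n) ≠ 0 := (ENNReal.ofReal_pos.2 (by positivity)).ne'
        rw [Measure.addHaar_ball_center _ x r, ← ENNReal.mul_le_mul_iff_right hV0 ENNReal.ofReal_ne_top, ← mul_assoc]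
        refine (mul_le_mul' h2 (le_refl (ENNReal.ofReal r))).trans_eq ?_
        ring
    _ = _ := by
        rw [lintegral_mul_const _ (by fun_prop), lintegral_Ioc_inv_rpow_half]
        ring

/-- If `|f x - f y|` is large, then the average of `|∇f|` is large on some ball centred at `x` or
at `y`. -/
lemma exists_ball_average_gradNorm_gt {f : EuclideanSpace ℝ (Fin n) → ℂ} (hf : ContDiff ℝ 1 f)
    {x y : EuclideanSpace ℝ (Fin n)} (hxy : 0 < dist x y) {M : ℝ≥0∞}
    (h : 4 * 2 ^ n * ENNReal.ofReal (dist x y) * M < ‖f x - f y‖ₑ) :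
    ∃ s, 0 < s ∧ s ≤ dist x y ∧ ∃ c, (c = x ∨ c = y) ∧
      M * ENNReal.ofReal ((dist x y / s) ^ (1 / 2 : ℝ)) * volume (Metric.ball c s) <
        ∫⁻ z in Metric.ball c s, ENNReal.ofReal (gradNorm f z) := by
  by_contra! hcon
  set r := dist x y with hr
  have hx := lintegral_ball_enorm_sub_le hf x hxy fun s h0 h1 => hcon s h0 h1 x (Or.inl rfl)
  have hy := lintegral_ball_enorm_sub_le hf y hxy fun s h0 h1 => hcon s h0 h1 y (Or.inr rfl)
  -- The ball of radius `r / 2` around the midpoint lies in both balls of radius `r`. Each of the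
  -- two oscillations contributes `2 r M`, and the volume ratio is `2 ^ n`; hence the constant `4 *
  -- 2 ^ n`.
  set m := midpoint ℝ x y with hm
  have hmx : Metric.ball m (r / 2) ⊆ Metric.ball x r :=
    Metric.ball_subset_ball' (by
      have : dist m x = r / 2 := by
        rw [hm, dist_midpoint_left (𝕜 := ℝ), Real.norm_of_nonneg zero_le_two]; ring
      linarith)
  have hmy : Metric.ball m (r / 2) ⊆ Metric.ball y r :=
    Metric.ball_subset_ball' (by
      have : dist m y = r / 2 := by
        rw [hm, dist_midpoint_right (𝕜 := ℝ), Real.norm_of_nonneg zero_le_two]; ring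
      linarith)
  have hV0 : volume (Metric.ball m (r / 2)) ≠ 0 :=
    (Metric.measure_ball_pos volume _ (by positivity)).ne'
  have hVt : volume (Metric.ball m (r / 2)) ≠ ∞ := measure_ball_lt_top.ne
  have hVr : ∀ c : EuclideanSpace ℝ (Fin n), volume (Metric.ball c r) = 2 ^ n * volume (Metric.ball m (r / 2)) := by
    intro c
    rw [show r = 2 * (r / 2) by ring, Measure.addHaar_ball_mul_of_pos _ _ two_pos,
      finrank_euclideanSpace_fin, show 2 * (r / 2) / 2 = r / 2 by ring,
      Measure.addHaar_ball_center _ m]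
    simp
  have hc : Continuous f := hf.continuous
  refine absurd h (not_lt.2 ?_)
  rw [← ENNReal.mul_le_mul_iff_left hV0 hVt]
  calc ‖f x - f y‖ₑ * volume (Metric.ball m (r / 2))
      = ∫⁻ z in Metric.ball m (r / 2), ‖f x - f y‖ₑ := by simp
    _ ≤ ∫⁻ z in Metric.ball m (r / 2), (‖f z - f x‖ₑ + ‖f z - f y‖ₑ) := by
        refine lintegral_mono fun z => ?_
        rw [show f x - f y = (f z - f y) - (f z - f x) by ring, add_comm]
        exact enorm_sub_le
    _ = (∫⁻ z in Metric.ball m (r / 2), ‖f z - f x‖ₑ) +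
          ∫⁻ z in Metric.ball m (r / 2), ‖f z - f y‖ₑ := lintegral_add_left (by fun_prop) _
    _ ≤ (∫⁻ z in Metric.ball x r, ‖f z - f x‖ₑ) + ∫⁻ z in Metric.ball y r, ‖f z - f y‖ₑ := by
        gcongr
    _ ≤ _ := add_le_add hx hy
    _ = _ := by rw [hVr, hVr]; ring

/-- A Vitali covering estimate for the product measure. -/
lemma prod_measure_vitali_le {p : ℝ} (hp : 1 ≤ p) {A : ℝ≥0}
    {μ : Measure (EuclideanSpace ℝ (Fin n))} [SFinite μ] (hμ : BallAp p A μ)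
    {F : EuclideanSpace ℝ (Fin n) → ℝ≥0∞} (k : ℝ≥0∞) {T : ℝ} (hT : 1 ≤ T) (R : ℝ) :
    k * (μ.prod μ) {z | ∃ s, 0 < s ∧ s ≤ R ∧ dist z.2 z.1 ≤ 2 * T * s ∧
        k * (μ (Metric.ball z.1 s) * μ (Metric.ball z.1 (T * s))) ≤
          ∫⁻ w in Metric.ball z.1 s, F w ∂μ} ≤
      (A * ENNReal.ofReal (4 ^ n) ^ p) * (A * ENNReal.ofReal (8 ^ n) ^ p) * ∫⁻ w, F w ∂μ := by
  set E := {z : EuclideanSpace ℝ (Fin n) × EuclideanSpace ℝ (Fin n) |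
    ∃ s, 0 < s ∧ s ≤ R ∧ dist z.2 z.1 ≤ 2 * T * s ∧
        k * (μ (Metric.ball z.1 s) * μ (Metric.ball z.1 (T * s))) ≤
          ∫⁻ w in Metric.ball z.1 s, F w ∂μ} with hE
  -- The covering is made in the single space, for the balls `B(x, s)`. The bound `R` on the radii
  -- is needed here but does not enter the constant.
  obtain ⟨u, hut, hdisj, hcov⟩ := Vitali.exists_disjoint_subfamily_covering_enlargement
    (fun b : EuclideanSpace ℝ (Fin n) × ℝ => Metric.ball b.1 b.2)
    {b | 0 < b.2 ∧ b.2 ≤ R ∧ k * (μ (Metric.ball b.1 b.2) * μ (Metric.ball b.1 (T * b.2))) ≤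
          ∫⁻ w in Metric.ball b.1 b.2, F w ∂μ} (fun b => b.2) 2 one_lt_two
    (fun b hb => hb.1.le) R (fun b hb => hb.2.1) (fun b hb => Metric.nonempty_ball.2 hb.1)
  have hcount : u.Countable := hdisj.countable_of_nonempty_interior fun b hb => by
    rw [Metric.isOpen_ball.interior_eq]
    exact Metric.nonempty_ball.2 (hut hb).1
  -- As `s ≤ 2 b.2` and the balls meet, `x` is within `3 b.2` of the centre, and `y` within `2 T s +
  -- 3 b.2 ≤ 7 T b.2`.
  have hsub : E ⊆ ⋃ b ∈ u, Metric.ball b.1 (4 * b.2) ×ˢ Metric.ball b.1 (8 * (T * b.2)) := by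
    rintro ⟨x, y⟩ ⟨s, hs, hsR, hd, hk⟩
    obtain ⟨b, hb, ⟨w, hw1, hw2⟩, hsb⟩ := hcov (x, s) ⟨hs, hsR, hk⟩
    simp only [Metric.mem_ball] at hw1 hw2 hsb hd
    have hb0 : 0 < b.2 := (hut hb).1
    have hx : dist x b.1 < 3 * b.2 := by
      have := dist_triangle_left x b.1 w
      linarith
    have hTb : b.2 ≤ T * b.2 := by nlinarith
    have hTs : T * s ≤ T * (2 * b.2) := by gcongr
    have hy : dist y b.1 < 8 * (T * b.2) := by
      have := dist_triangle y x b.1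
      nlinarith
    refine Set.mem_iUnion₂.2 ⟨b, hb, ?_, ?_⟩
    · simp only [Metric.mem_ball]; linarith
    · simpa only [Metric.mem_ball] using hy
  have hball : ∀ (c : EuclideanSpace ℝ (Fin n)) {s m : ℝ}, 0 < s → 1 ≤ m →
      μ (Metric.ball c (m * s)) ≤ A * ENNReal.ofReal (m ^ n) ^ p * μ (Metric.ball c s) :=
    fun c s m hs hm => hμ.measure_ball_le hp hs (by linarith)
      (Metric.ball_subset_ball (by nlinarith))
  calc k * (μ.prod μ) E
      ≤ k * ∑' b : u, (μ.prod μ)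
          (Metric.ball b.1.1 (4 * b.1.2) ×ˢ Metric.ball b.1.1 (8 * (T * b.1.2))) := by
        gcongr
        exact (measure_mono hsub).trans (measure_biUnion_le _ hcount _)
    _ = ∑' b : u, k * (μ (Metric.ball b.1.1 (4 * b.1.2)) *
          μ (Metric.ball b.1.1 (8 * (T * b.1.2)))) := by
        rw [ENNReal.tsum_mul_left]
        simp_rw [Measure.prod_prod]
    _ ≤ ∑' b : u, (A * ENNReal.ofReal (4 ^ n) ^ p) * (A * ENNReal.ofReal (8 ^ n) ^ p) *
          ∫⁻ w in Metric.ball b.1.1 b.1.2, F w ∂μ := by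
        refine ENNReal.tsum_le_tsum fun b => ?_
        obtain ⟨hb0, hbR, hbk⟩ := hut b.2
        have hTb : 0 < T * b.1.2 := by positivity
        calc _ ≤ k * ((A * ENNReal.ofReal (4 ^ n) ^ p * μ (Metric.ball b.1.1 b.1.2)) *
              (A * ENNReal.ofReal (8 ^ n) ^ p * μ (Metric.ball b.1.1 (T * b.1.2)))) := by
              gcongr
              · exact hball _ hb0 (by norm_num)
              · exact hball _ hTb (by norm_num)
          _ = (A * ENNReal.ofReal (4 ^ n) ^ p) * (A * ENNReal.ofReal (8 ^ n) ^ p) *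
              (k * (μ (Metric.ball b.1.1 b.1.2) * μ (Metric.ball b.1.1 (T * b.1.2)))) := by ring
          _ ≤ _ := by gcongr
    _ = (A * ENNReal.ofReal (4 ^ n) ^ p) * (A * ENNReal.ofReal (8 ^ n) ^ p) *
          ∫⁻ w in ⋃ b ∈ u, Metric.ball b.1 b.2, F w ∂μ := by
        rw [ENNReal.tsum_mul_left, lintegral_biUnion hcount (fun b _ => measurableSet_ball) hdisj]
    _ ≤ _ := by
        gcongr
        exact Measure.restrict_le_self

lemma prod_measure_preimage_swap {α : Type*} [MeasurableSpace α] (μ : Measure α) [SFinite μ]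
    (E : Set (α × α)) : (μ.prod μ) (Prod.swap ⁻¹' E) = (μ.prod μ) E :=
  Measure.measurePreserving_swap.measure_preimage_equiv (f := MeasurableEquiv.prodComm) E

/-- Inserting the lower bound for the Lebesgue average into the `A_p` condition and cancelling the
volume. This converts a large average of `|∇f|` into a large `μ`-energy. -/
lemma BallAp.mul_measure_mul_measure_le {p : ℝ} (hp : 1 ≤ p) {A : ℝ≥0}
    {μ : Measure (EuclideanSpace ℝ (Fin n))} (hμ : BallAp p A μ)
    {g : EuclideanSpace ℝ (Fin n) → ℝ≥0∞} (hg : Measurable g) {c : EuclideanSpace ℝ (Fin n)}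
    {s : ℝ} (hs : 0 < s) {N : ℝ≥0∞}
    (h : N * volume (Metric.ball c s) ≤ ∫⁻ z in Metric.ball c s, g z) :
    N ^ p * μ (Metric.ball c s) ≤ A * ∫⁻ z in Metric.ball c s, g z ^ p ∂μ := by
  have hp0 : 0 ≤ p := by linarith
  have hV0 : volume (Metric.ball c s) ≠ 0 := (Metric.measure_ball_pos volume _ hs).ne'
  have hVt : volume (Metric.ball c s) ≠ ∞ := measure_ball_lt_top.ne
  have hVp0 : volume (Metric.ball c s) ^ p ≠ 0 := (ENNReal.rpow_pos hV0.bot_lt hVt).ne'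
  have hVpt : volume (Metric.ball c s) ^ p ≠ ∞ := ENNReal.rpow_ne_top_of_nonneg hp0 hVt
  rw [← ENNReal.mul_le_mul_iff_right hVp0 hVpt]
  calc _ = (N * volume (Metric.ball c s)) ^ p * μ (Metric.ball c s) := by
        rw [ENNReal.mul_rpow_of_nonneg _ _ hp0]; ring
    _ ≤ (∫⁻ z in Metric.ball c s, g z) ^ p * μ (Metric.ball c s) := by gcongr
    _ ≤ _ := hμ c s hs g hg
    _ = _ := by ring

/-- Every pair in the superlevel set comes, up to a swap, with a ball which carries a large part of
the energy `∫ |∇f| ^ p dμ`. -/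
lemma exists_ball_energy_ge {p : ℝ} (hp : 1 ≤ p) {A : ℝ≥0}
    {μ : Measure (EuclideanSpace ℝ (Fin n))} (hμ : BallAp p A μ)
    {f : EuclideanSpace ℝ (Fin n) → ℂ} (hf : ContDiff ℝ 1 f) {t : ℝ} (ht : 0 < t)
    {x y : EuclideanSpace ℝ (Fin n)}
    (h : ENNReal.ofReal (t * dist x y) * μ (Metric.ball x (dist x y)) ^ (1 / p) <
      ‖f x - f y‖ₑ) :
    ∃ j : ℕ, ∃ s, 0 < s ∧ s ≤ dist x y ∧ dist x y ≤ 2 * 2 ^ j * s ∧ ∃ c, (c = x ∨ c = y) ∧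
      ((4 * 2 ^ n : ℝ≥0∞)⁻¹ ^ p * ENNReal.ofReal (t ^ p) * ENNReal.ofReal (2 ^ (1 / 2 : ℝ)) ^ j) *
        (μ (Metric.ball c s) * μ (Metric.ball c (2 ^ j * s))) ≤
      ∫⁻ w in Metric.ball c s, A * (A * ENNReal.ofReal (2 ^ n) ^ p) *
        ENNReal.ofReal (gradNorm f w) ^ p ∂μ := by
  have hp0 : 0 < p := by linarith
  have hxy : 0 < dist x y := by
    rw [dist_pos]
    rintro rfl
    simp at h
  set r := dist x y with hr
  set P : ℝ≥0∞ := 4 * 2 ^ n with hP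
  have hP0 : P ≠ 0 := by positivity
  have hPt : P ≠ ∞ := by simp [hP, ENNReal.mul_eq_top]
  -- `M` is chosen so that `4 * 2 ^ n * r * M` is exactly the left side of `h`.
  obtain ⟨s, hs, hsr, c, hc, hlt⟩ := exists_ball_average_gradNorm_gt hf hxy
    (M := P⁻¹ * (ENNReal.ofReal t * μ (Metric.ball x r) ^ (1 / p))) (by
      refine lt_of_eq_of_lt ?_ h
      rw [ENNReal.ofReal_mul ht.le]
      calc _ = (P * P⁻¹) * (ENNReal.ofReal t * ENNReal.ofReal r * μ (Metric.ball x r) ^ (1 / p)) := by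
            ring
        _ = _ := by rw [ENNReal.mul_inv_cancel hP0 hPt, one_mul])
  -- The dyadic scale: `2 ^ j ≤ r / s < 2 ^ (j + 1)`.
  obtain ⟨j, hj1, hj2⟩ := exists_nat_pow_near ((one_le_div hs).2 hsr) (one_lt_two (α := ℝ))
  rw [le_div_iff₀ hs] at hj1
  rw [div_lt_iff₀ hs, pow_succ] at hj2
  refine ⟨j, s, hs, hsr, by linarith, c, hc, ?_⟩
  have hG : Measurable fun z => ENNReal.ofReal (gradNorm f z) :=
    (ENNReal.continuous_ofReal.comp (continuous_gradNorm hf)).measurable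
  have key := hμ.mul_measure_mul_measure_le hp hG hs hlt.le
  rw [ENNReal.mul_rpow_of_nonneg _ _ hp0.le, ENNReal.mul_rpow_of_nonneg _ _ hp0.le,
    ENNReal.mul_rpow_of_nonneg _ _ hp0.le, ← ENNReal.rpow_mul, one_div_mul_cancel hp0.ne',
    ENNReal.rpow_one, ENNReal.ofReal_rpow_of_pos ht] at key
  -- Since `r / s ≥ 1` and `p ≥ 1`, the exponent `p` may be dropped, which leaves a rate independent
  -- of `p`.
  have hθ : ENNReal.ofReal (2 ^ (1 / 2 : ℝ)) ^ j ≤ ENNReal.ofReal ((r / s) ^ (1 / 2 : ℝ)) ^ p := by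
    have h1 : ENNReal.ofReal (2 ^ (1 / 2 : ℝ)) ^ j ≤ ENNReal.ofReal ((r / s) ^ (1 / 2 : ℝ)) := by
      rw [← ENNReal.ofReal_pow (by positivity)]
      apply ENNReal.ofReal_le_ofReal
      rw [← Real.rpow_natCast, ← Real.rpow_mul zero_le_two, mul_comm, Real.rpow_mul zero_le_two,
        Real.rpow_natCast]
      exact Real.rpow_le_rpow (by positivity) ((le_div_iff₀ hs).2 hj1) (by norm_num)
    refine h1.trans ?_
    have h2 : (1 : ℝ≥0∞) ≤ ENNReal.ofReal ((r / s) ^ (1 / 2 : ℝ)) :=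
      ENNReal.one_le_ofReal.2 (Real.one_le_rpow ((one_le_div hs).2 hsr) (by norm_num))
    conv_lhs => rw [← ENNReal.rpow_one (ENNReal.ofReal ((r / s) ^ (1 / 2 : ℝ)))]
    exact ENNReal.rpow_le_rpow_of_exponent_le h2 hp
  have hdoub : μ (Metric.ball c (2 ^ j * s)) ≤
      A * ENNReal.ofReal (2 ^ n) ^ p * μ (Metric.ball x r) := by
    refine le_trans (measure_mono ?_)
      (hμ.measure_ball_le hp hxy two_pos (Metric.ball_subset_ball (by linarith)))
    refine Metric.ball_subset_ball' ?_
    have : dist c x ≤ r := by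
      rcases hc with rfl | rfl
      · simpa using hxy.le
      · rw [dist_comm]
    linarith
  rw [lintegral_const_mul' _ _ (by finiteness)]
  calc _ ≤ (P⁻¹ ^ p * ENNReal.ofReal (t ^ p) * ENNReal.ofReal ((r / s) ^ (1 / 2 : ℝ)) ^ p) *
        (μ (Metric.ball c s) * (A * ENNReal.ofReal (2 ^ n) ^ p * μ (Metric.ball x r))) := by
        gcongr
    _ = (A * ENNReal.ofReal (2 ^ n) ^ p) * (P⁻¹ ^ p * (ENNReal.ofReal (t ^ p) *
        μ (Metric.ball x r)) * ENNReal.ofReal ((r / s) ^ (1 / 2 : ℝ)) ^ p *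
        μ (Metric.ball c s)) := by ring
    _ ≤ _ := by
      refine (mul_le_mul_right key _).trans_eq ?_
      ring

/-- The set of all `(x, y)` with `|f(x) - f(y)| > t |x - y| μ(B(x, |x - y|)) ^ (1 / p)`. -/
def differenceSet (p : ℝ) (μ : Measure (EuclideanSpace ℝ (Fin n)))
    (f : EuclideanSpace ℝ (Fin n) → ℂ) (t : ℝ) :
    Set (EuclideanSpace ℝ (Fin n) × EuclideanSpace ℝ (Fin n)) :=
  {z | ENNReal.ofReal (t * dist z.1 z.2) * μ (Metric.ball z.1 (dist z.1 z.2)) ^ (1 / p) <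
    ‖f z.1 - f z.2‖ₑ}

/-- The upper bound: the weak-type estimate for an `A_p` measure. -/
theorem exists_weak_le_gradient_energy (n : ℕ) {p : ℝ} (hp : 1 ≤ p) (A : ℝ≥0) :
    ∃ C : ℝ≥0, ∀ (μ : Measure (EuclideanSpace ℝ (Fin n))) [SFinite μ], BallAp p A μ →
      ∀ f : EuclideanSpace ℝ (Fin n) → ℂ, ContDiff ℝ 1 f → ∀ t : ℝ, 0 < t →
        ENNReal.ofReal (t ^ p) * (μ.prod μ) (differenceSet p μ f t) ≤ C * ∫⁻ x, ENNReal.ofReal (gradNorm f x) ^ p ∂μ := by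
  have hp0 : 0 < p := by linarith
  set κ : ℝ≥0∞ := (4 * 2 ^ n : ℝ≥0∞)⁻¹ ^ p with hκ
  have hP : (4 * 2 ^ n : ℝ≥0∞) ≠ ∞ := by finiteness
  have hκ0 : κ ≠ 0 := (ENNReal.rpow_pos (ENNReal.inv_pos.2 hP)
    (ENNReal.inv_ne_top.2 (by positivity))).ne'
  have hκt : κ ≠ ∞ := ENNReal.rpow_ne_top_of_nonneg hp0.le (ENNReal.inv_ne_top.2 (by positivity))
  set θ : ℝ≥0∞ := ENNReal.ofReal (2 ^ (1 / 2 : ℝ)) with hθ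
  have hθ1 : 1 < θ := by
    rw [hθ, ENNReal.one_lt_ofReal]
    exact Real.one_lt_rpow one_lt_two (by norm_num)
  have hθt : θ ≠ ∞ := ENNReal.ofReal_ne_top
  set L : ℝ≥0∞ := (A * ENNReal.ofReal (4 ^ n) ^ p) * (A * ENNReal.ofReal (8 ^ n) ^ p) *
    (A * (A * ENNReal.ofReal (2 ^ n) ^ p)) with hL
  have hLt : L ≠ ∞ := by
    have : ∀ a : ℝ, ENNReal.ofReal a ^ p ≠ ∞ := fun a =>
      ENNReal.rpow_ne_top_of_nonneg hp0.le ENNReal.ofReal_ne_top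
    have h2 := this (2 ^ n)
    have h4 := this (4 ^ n)
    have h8 := this (8 ^ n)
    finiteness
  have hS : (1 - θ⁻¹)⁻¹ ≠ ∞ := by
    rw [ENNReal.inv_ne_top]
    exact (tsub_pos_of_lt (ENNReal.inv_lt_one.2 hθ1)).ne'
  have hCt : κ⁻¹ * (2 * L * (1 - θ⁻¹)⁻¹) ≠ ∞ := by
    have := ENNReal.inv_ne_top.2 hκ0
    finiteness
  refine ⟨(κ⁻¹ * (2 * L * (1 - θ⁻¹)⁻¹)).toNNReal, fun μ _ hμ f hf t ht => ?_⟩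
  rw [ENNReal.coe_toNNReal hCt]
  set I := ∫⁻ x, ENNReal.ofReal (gradNorm f x) ^ p ∂μ with hI
  set D := differenceSet p μ f t with hD
  -- Truncation bounds the radii, as the Vitali covering requires. The estimate is uniform in `N`,
  -- and `N → ∞` by continuity from below.
  have hcut : ∀ N : ℕ, κ * (ENNReal.ofReal (t ^ p) * (μ.prod μ) (D ∩ {z | dist z.1 z.2 ≤ N})) ≤
      2 * L * (1 - θ⁻¹)⁻¹ * I := by
    intro N
    set E : ℕ → Set (EuclideanSpace ℝ (Fin n) × EuclideanSpace ℝ (Fin n)) := fun j =>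
      {z | ∃ s, 0 < s ∧ s ≤ (N : ℝ) ∧ dist z.2 z.1 ≤ 2 * 2 ^ j * s ∧
        (κ * ENNReal.ofReal (t ^ p) * θ ^ j) *
          (μ (Metric.ball z.1 s) * μ (Metric.ball z.1 (2 ^ j * s))) ≤
          ∫⁻ w in Metric.ball z.1 s, A * (A * ENNReal.ofReal (2 ^ n) ^ p) *
            ENNReal.ofReal (gradNorm f w) ^ p ∂μ} with hE
    have hEj : ∀ j, κ * ENNReal.ofReal (t ^ p) * (μ.prod μ) (E j) ≤ L * I * θ⁻¹ ^ j := by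
      intro j
      have := prod_measure_vitali_le hp hμ (F := fun w => A * (A * ENNReal.ofReal (2 ^ n) ^ p) *
        ENNReal.ofReal (gradNorm f w) ^ p) (κ * ENNReal.ofReal (t ^ p) * θ ^ j)
        (one_le_pow₀ one_le_two : (1 : ℝ) ≤ 2 ^ j) N
      rw [lintegral_const_mul' _ _ (by finiteness)] at this
      rw [← ENNReal.inv_pow, ← div_eq_mul_inv, ENNReal.le_div_iff_mul_le
        (Or.inl (pow_ne_zero _ (by positivity))) (Or.inl (ENNReal.pow_ne_top hθt))]
      calc _ = κ * ENNReal.ofReal (t ^ p) * θ ^ j * (μ.prod μ) (E j) := by ring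
        _ ≤ _ := this
        _ = _ := by ring
    -- Pairs whose good ball is centred at `y` fall into the swapped set, which has the same product
    -- measure.
    have hsub : D ∩ {z | dist z.1 z.2 ≤ N} ⊆ ⋃ j, (E j ∪ Prod.swap ⁻¹' E j) := by
      rintro ⟨x, y⟩ ⟨hz, hN⟩
      obtain ⟨j, s, hs, hsr, hrs, c, hc, hle⟩ := exists_ball_energy_ge hp hμ hf ht hz
      have hN' : dist x y ≤ N := hN
      refine Set.mem_iUnion.2 ⟨j, ?_⟩
      rcases hc with rfl | rfl
      · exact Or.inl ⟨s, hs, hsr.trans hN', by rwa [dist_comm], hle⟩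
      · exact Or.inr ⟨s, hs, hsr.trans hN', hrs, hle⟩
    calc κ * (ENNReal.ofReal (t ^ p) * (μ.prod μ) (D ∩ {z | dist z.1 z.2 ≤ N}))
        ≤ κ * (ENNReal.ofReal (t ^ p) * ∑' j, (2 * (μ.prod μ) (E j))) := by
          gcongr
          refine (measure_mono hsub).trans ((measure_iUnion_le _).trans
            (ENNReal.tsum_le_tsum fun j => ?_))
          refine (measure_union_le _ _).trans_eq ?_
          rw [prod_measure_preimage_swap, two_mul]
      _ = 2 * ∑' j, κ * ENNReal.ofReal (t ^ p) * (μ.prod μ) (E j) := by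
          rw [ENNReal.tsum_mul_left, ENNReal.tsum_mul_left]; ring
      _ ≤ 2 * ∑' j, L * I * θ⁻¹ ^ j := by
          exact mul_le_mul_right (ENNReal.tsum_le_tsum hEj) 2
      _ = _ := by
          rw [ENNReal.tsum_mul_left, ENNReal.tsum_geometric]; ring
  have hmono : Monotone fun N : ℕ => D ∩ {z | dist z.1 z.2 ≤ N} := fun a b hab =>
    Set.inter_subset_inter_right _ fun z hz => le_trans (b := (a : ℝ)) hz (by exact_mod_cast hab)
  have hunion : D = ⋃ N : ℕ, D ∩ {z | dist z.1 z.2 ≤ N} := by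
    rw [← Set.inter_iUnion]
    refine (Set.inter_eq_left.2 fun z _ => ?_).symm
    obtain ⟨N, hN⟩ := exists_nat_ge (dist z.1 z.2)
    exact Set.mem_iUnion.2 ⟨N, hN⟩
  rw [hunion, hmono.measure_iUnion, ENNReal.mul_iSup]
  refine iSup_le fun N => ?_
  rw [mul_assoc, ← ENNReal.mul_le_iff_le_inv hκ0 hκt]
  exact hcut N

end UpperBound

/-! ### The lower bound: sections of the level sets and Fatou's lemma. -/

section LowerBound

open Filter Topology

variable {n : ℕ}

lemma measurableSet_differenceSet (p : ℝ) (μ : Measure (EuclideanSpace ℝ (Fin n))) [SFinite μ]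
    {f : EuclideanSpace ℝ (Fin n) → ℂ} (hf : Continuous f) (t : ℝ) :
    MeasurableSet (differenceSet p μ f t) := by
  have h : Measurable fun z : EuclideanSpace ℝ (Fin n) × EuclideanSpace ℝ (Fin n) =>
      μ (Metric.ball z.1 (dist z.1 z.2)) := by
    have hopen : IsOpen {q : (EuclideanSpace ℝ (Fin n) × EuclideanSpace ℝ (Fin n)) ×
        EuclideanSpace ℝ (Fin n) | dist q.2 q.1.1 < dist q.1.1 q.1.2} :=
      isOpen_lt (by fun_prop) (by fun_prop)
    exact measurable_measure_prodMk_left (ν := μ) hopen.measurableSet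
  exact measurableSet_lt (Measurable.mul (by fun_prop) (h.pow_const _)) (by fun_prop)

/-- An `A_p` measure which vanishes on some ball vanishes identically. -/
lemma BallAp.eq_zero {p : ℝ} (hp : 1 ≤ p) {A : ℝ≥0}
    {μ : Measure (EuclideanSpace ℝ (Fin n))} (hμ : BallAp p A μ)
    {x : EuclideanSpace ℝ (Fin n)} {δ : ℝ} (hδ : 0 < δ) (h : μ (Metric.ball x δ) = 0) : μ = 0 := by
  have hk : ∀ k : ℕ, μ (Metric.ball x ((k + 1) * δ)) = 0 := by
    intro k
    have := hμ.measure_ball_le hp (x := x) (y := x) hδ (m := k + 1) (by positivity)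
      (Metric.ball_subset_ball (by
        have : (0 : ℝ) ≤ k * δ := by positivity
        linarith))
    simpa [h] using this
  rw [← Measure.measure_univ_eq_zero]
  have hU : (Set.univ : Set (EuclideanSpace ℝ (Fin n))) =
      ⋃ k : ℕ, Metric.ball x ((k + 1) * δ) := by
    refine (Set.eq_univ_of_forall fun y => ?_).symm
    obtain ⟨k, hk⟩ := exists_nat_gt (dist y x / δ)
    rw [div_lt_iff₀ hδ] at hk
    refine Set.mem_iUnion.2 ⟨k, ?_⟩
    rw [Metric.mem_ball]
    linarith
  rw [hU]
  exact measure_iUnion_null hk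

/-- For small `a` there is a small radius at which the measure of the ball passes through `a`. -/
lemma exists_radius_measure_ball {μ : Measure (EuclideanSpace ℝ (Fin n))} [NullSingletonClass μ]
    {x : EuclideanSpace ℝ (Fin n)} {δ : ℝ} (hδ : 0 < δ) (hfin : μ (Metric.ball x δ) ≠ ∞)
    {a : ℝ≥0∞} (ha : 0 < a) (haδ : a ≤ μ (Metric.ball x δ)) :
    ∃ r, 0 < r ∧ r < δ ∧ μ (Metric.ball x r) < a ∧ a ≤ μ (Metric.ball x (2 * r)) := by
  have hanti : Antitone fun k : ℕ => Metric.ball x (δ / 2 ^ k) := fun k l hkl =>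
    Metric.ball_subset_ball (by gcongr; norm_num)
  have hlim0 : Tendsto (fun k : ℕ => δ / 2 ^ k) atTop (𝓝 0) :=
    tendsto_const_nhds.div_atTop (tendsto_pow_atTop_atTop_of_one_lt one_lt_two)
  have hlim : Tendsto (fun k : ℕ => μ (Metric.ball x (δ / 2 ^ k))) atTop (𝓝 0) := by
    have h1 := tendsto_measure_iInter_atTop (μ := μ)
      (fun k : ℕ => (measurableSet_ball (x := x) (ε := δ / 2 ^ k)).nullMeasurableSet)
      hanti ⟨0, by simpa using hfin⟩
    have h2 : ⋂ k : ℕ, Metric.ball x (δ / 2 ^ k) ⊆ {x} := by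
      intro y hy
      rw [Set.mem_iInter] at hy
      have : dist y x ≤ 0 := ge_of_tendsto' hlim0 fun k => (Metric.mem_ball.1 (hy k)).le
      exact dist_le_zero.1 this
    rwa [measure_mono_null h2 (measure_singleton x)] at h1
  have hex : ∃ k : ℕ, μ (Metric.ball x (δ / 2 ^ k)) < a := (hlim.eventually_lt_const ha).exists
  classical
  -- The first dyadic radius with measure below `a` is not `δ` itself, so its double is the
  -- preceding radius, where the measure is still at least `a`.
  obtain ⟨m, hm⟩ : ∃ m, Nat.find hex = m + 1 := Nat.exists_eq_succ_of_ne_zero fun h0 => by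
    have := Nat.find_spec hex
    rw [h0, pow_zero, div_one] at this
    exact absurd this (not_lt.2 haδ)
  refine ⟨δ / 2 ^ (m + 1), by positivity, div_lt_self hδ (one_lt_pow₀ one_lt_two (by simp)), ?_, ?_⟩
  · have := Nat.find_spec hex
    rwa [hm] at this
  · have := Nat.find_min hex (m := m) (by omega)
    rw [not_lt] at this
    rwa [show 2 * (δ / 2 ^ (m + 1)) = δ / 2 ^ m by rw [pow_succ]; field_simp]

/-- The largest of the `n` partial derivatives serves. As `f` is complex-valued, its gradient need
not be a real direction of steepest change; a coordinate direction replaces it at the cost of `√n`.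
-/
lemma exists_gradNorm_le_sqrt_mul (hn : 1 ≤ n) (f : EuclideanSpace ℝ (Fin n) → ℂ)
    (x : EuclideanSpace ℝ (Fin n)) :
    ∃ i, gradNorm f x ≤ √n * ‖fderiv ℝ f x (EuclideanSpace.single i 1)‖ := by
  have : Nonempty (Fin n) := ⟨⟨0, hn⟩⟩
  obtain ⟨i, hi⟩ := Finite.exists_max fun i => ‖fderiv ℝ f x (EuclideanSpace.single i 1)‖
  refine ⟨i, ?_⟩
  rw [gradNorm, ← Real.sqrt_sq (norm_nonneg (fderiv ℝ f x (EuclideanSpace.single i 1))),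
    ← Real.sqrt_mul (by positivity)]
  refine Real.sqrt_le_sqrt ?_
  calc _ ≤ ∑ _j : Fin n, ‖fderiv ℝ f x (EuclideanSpace.single i 1)‖ ^ 2 :=
        Finset.sum_le_sum fun j _ => pow_le_pow_left₀ (norm_nonneg _) (hi j) 2
    _ = _ := by simp

/-- Near a point with `∇f(x) ≠ 0`, every ball around `x` contains a ball of comparable size on which
the difference quotients of `f` are at least a multiple of `|∇f(x)|`. -/
lemma exists_ball_differenceQuotient_ge (hn : 1 ≤ n) {f : EuclideanSpace ℝ (Fin n) → ℂ}
    {x : EuclideanSpace ℝ (Fin n)} (hf : DifferentiableAt ℝ f x) (hg : 0 < gradNorm f x) :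
    ∃ δ > 0, ∀ r, 0 < r → r < δ → ∃ c, Metric.ball c (r / (8 * √n)) ⊆ Metric.ball x r ∧
      ∀ y ∈ Metric.ball c (r / (8 * √n)), 0 < dist x y ∧
        gradNorm f x / (4 * √n) * dist x y ≤ ‖f x - f y‖ := by
  obtain ⟨i, hi⟩ := exists_gradNorm_le_sqrt_mul hn f x
  set g := gradNorm f x with hgdef
  set N := √(n : ℝ) with hN
  have hN1 : 1 ≤ N := Real.one_le_sqrt.2 (by exact_mod_cast hn)
  have hN0 : 0 < N := by linarith
  set e : EuclideanSpace ℝ (Fin n) := EuclideanSpace.single i 1 with he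
  have hen : ‖e‖ = 1 := by simp [he]
  -- The budget, in units of `g r / N`: the step `(r / 2) e` yields `1/2`, the deviation `w` costs
  -- `1/8` and the Taylor remainder `1/8`, leaving `1/4`.
  have hε : 0 < g / (8 * N) := by positivity
  obtain ⟨δ, hδ, hball⟩ := Metric.eventually_nhds_iff.1 (hf.hasFDerivAt.isLittleO.bound hε)
  refine ⟨δ, hδ, fun r hr hrδ => ⟨x + (r / 2) • e, ?_, ?_⟩⟩
  all_goals
    have hη : r / (8 * N) ≤ r / 8 := by gcongr; linarith
  · refine Metric.ball_subset_ball' ?_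
    rw [dist_eq_norm, add_sub_cancel_left, norm_smul, hen, Real.norm_of_nonneg (by positivity)]
    linarith
  · intro y hy
    rw [Metric.mem_ball, dist_eq_norm] at hy
    set w := y - (x + (r / 2) • e) with hw
    have hyx : y - x = (r / 2) • e + w := by rw [hw]; abel
    have hre : ‖(r / 2) • e‖ = r / 2 := by
      rw [norm_smul, hen, Real.norm_of_nonneg (by positivity), mul_one]
    have hup : ‖y - x‖ ≤ r := by
      rw [hyx]; refine (norm_add_le _ _).trans ?_; linarith
    have hlow : 0 < ‖y - x‖ := by
      have := norm_sub_le_norm_add ((r / 2) • e) w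
      rw [hyx]; linarith
    have hyδ : dist y x < δ := by rw [dist_eq_norm]; linarith
    have hL := hball hyδ
    have hLw : ‖fderiv ℝ f x w‖ ≤ g * (r / (8 * N)) :=
      (norm_fderiv_apply_le f x w).trans (by gcongr)
    have hLe : r / 2 * (g / N) ≤ ‖fderiv ℝ f x ((r / 2) • e)‖ := by
      rw [map_smul, norm_smul, Real.norm_of_nonneg (by positivity)]
      gcongr
      rw [div_le_iff₀ hN0, mul_comm]
      exact hi
    have hLy : r / 2 * (g / N) - g * (r / (8 * N)) ≤ ‖fderiv ℝ f x (y - x)‖ := by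
      rw [hyx, map_add]
      have := norm_sub_le_norm_add (fderiv ℝ f x ((r / 2) • e)) (fderiv ℝ f x w)
      linarith
    have h1 : ‖fderiv ℝ f x (y - x)‖ ≤ ‖f y - f x‖ + g / (8 * N) * ‖y - x‖ := by
      have := norm_sub_norm_le (fderiv ℝ f x (y - x)) (f y - f x)
      rw [norm_sub_rev (fderiv ℝ f x (y - x))] at this
      linarith
    have h2 : r / 2 * (g / N) - g * (r / (8 * N)) = 3 * (g / (8 * N) * r) := by
      field_simp; ring
    have h3 : g / (8 * N) * ‖y - x‖ ≤ g / (8 * N) * r := by gcongr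
    have h4 : g / (4 * N) = 2 * (g / (8 * N)) := by field_simp; ring
    rw [dist_comm, dist_eq_norm, norm_sub_rev (f x), h4]
    exact ⟨hlow, by linarith⟩

/-- With `b = |∇f(x)| / (4 √n k)`, a radius with `μ(B(x, r)) < b ^ p ≤ μ(B(x, 2r))` puts a ball of
radius `r / (8 √n)` into the section. By doubling its measure is at least a multiple of `b ^ p`, and
`k ^ p * b ^ p` no longer depends on `k`. -/
lemma eventually_gradNorm_rpow_le (hn : 1 ≤ n) {p : ℝ} (hp : 1 ≤ p) {A : ℝ≥0}
    {μ : Measure (EuclideanSpace ℝ (Fin n))} [NullSingletonClass μ] (hμ : BallAp p A μ) (hμ0 : μ ≠ 0)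
    (hfin : ∀ x r, μ (Metric.ball x r) ≠ ∞) {f : EuclideanSpace ℝ (Fin n) → ℂ}
    {x : EuclideanSpace ℝ (Fin n)} (hf : DifferentiableAt ℝ f x) :
    ∀ᶠ k : ℕ in atTop, ENNReal.ofReal (gradNorm f x) ^ p ≤
      ENNReal.ofReal (4 * √n) ^ p * (A * ENNReal.ofReal ((16 * √n) ^ n) ^ p) *
        (ENNReal.ofReal ((k : ℝ) ^ p) * μ (Prod.mk x ⁻¹' differenceSet p μ f k)) := by
  have hp0 : 0 < p := by linarith
  rcases (gradNorm_nonneg f x).eq_or_lt with hg | hg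
  · simp [← hg, ENNReal.zero_rpow_of_pos hp0]
  obtain ⟨δ, hδ, hδr⟩ := exists_ball_differenceQuotient_ge hn hf hg
  set g := gradNorm f x with hgdef
  set N := √(n : ℝ) with hN
  have hN0 : 0 < N := Real.sqrt_pos.2 (by exact_mod_cast hn)
  set b : ℕ → ℝ≥0∞ := fun k => ENNReal.ofReal (g / (4 * N) / k) with hb
  have hblim : Tendsto (fun k => b k ^ p) atTop (𝓝 0) := by
    have h1 : Tendsto (fun k : ℕ => g / (4 * N) / (k : ℝ)) atTop (𝓝 0) :=
      tendsto_const_div_atTop_nhds_zero_nat _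
    have h2 := (ENNReal.continuous_rpow_const (y := p)).continuousAt.tendsto.comp
      (ENNReal.tendsto_ofReal h1)
    simpa [ENNReal.zero_rpow_of_pos hp0, Function.comp_def] using h2
  have hpos : 0 < μ (Metric.ball x δ) :=
    pos_iff_ne_zero.2 fun h => hμ0 (hμ.eq_zero hp hδ h)
  filter_upwards [hblim.eventually_lt_const hpos, eventually_ge_atTop 1] with k hk hk1
  have hk0 : (0 : ℝ) < k := by exact_mod_cast hk1
  have hbk : 0 < b k := ENNReal.ofReal_pos.2 (by positivity)
  obtain ⟨r, hr, hrδ, hra, har⟩ := exists_radius_measure_ball hδ (hfin x δ)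
    (ENNReal.rpow_pos hbk ENNReal.ofReal_ne_top) hk.le
  obtain ⟨c, hcsub, hc⟩ := hδr r hr hrδ
  have hsub : Metric.ball c (r / (8 * N)) ⊆ Prod.mk x ⁻¹' differenceSet p μ f k := by
    intro y hy
    obtain ⟨hd, hle⟩ := hc y hy
    have hdr : dist x y ≤ r := by
      rw [dist_comm]; exact (Metric.mem_ball.1 (hcsub hy)).le
    have h1 : μ (Metric.ball x (dist x y)) ^ (1 / p) < b k := by
      rw [one_div, ENNReal.rpow_inv_lt_iff hp0]
      exact (measure_mono (Metric.ball_subset_ball hdr)).trans_lt hra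
    change ENNReal.ofReal (k * dist x y) * μ (Metric.ball x (dist x y)) ^ (1 / p) < ‖f x - f y‖ₑ
    calc _ < ENNReal.ofReal (k * dist x y) * b k :=
          ENNReal.mul_lt_mul_right (ENNReal.ofReal_pos.2 (by positivity)).ne' ENNReal.ofReal_ne_top h1
      _ = ENNReal.ofReal (g / (4 * N) * dist x y) := by
          rw [hb, ← ENNReal.ofReal_mul (by positivity)]
          congr 1
          field_simp
      _ ≤ _ := by
          rw [← ofReal_norm]
          exact ENNReal.ofReal_le_ofReal hle
  have hdoub : μ (Metric.ball x (2 * r)) ≤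
      A * ENNReal.ofReal ((16 * N) ^ n) ^ p * μ (Metric.ball c (r / (8 * N))) := by
    have e : 2 * r = 16 * N * (r / (8 * N)) := by field_simp; ring
    rw [e]
    refine hμ.measure_ball_le hp (by positivity) (by positivity) ?_
    rw [← e]
    exact hcsub.trans (Metric.ball_subset_ball (by linarith))
  calc ENNReal.ofReal g ^ p
      = ENNReal.ofReal (4 * N) ^ p * (ENNReal.ofReal ((k : ℝ) ^ p) * b k ^ p) := by
        rw [← ENNReal.ofReal_rpow_of_pos hk0, ← ENNReal.mul_rpow_of_nonneg _ _ hp0.le,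
          ← ENNReal.mul_rpow_of_nonneg _ _ hp0.le, hb, ← ENNReal.ofReal_mul (by positivity),
          ← ENNReal.ofReal_mul (by positivity)]
        congr 2
        field_simp
    _ ≤ ENNReal.ofReal (4 * N) ^ p * (ENNReal.ofReal ((k : ℝ) ^ p) *
          (A * ENNReal.ofReal ((16 * N) ^ n) ^ p * μ (Prod.mk x ⁻¹' differenceSet p μ f k))) := by
        gcongr
        refine (har.trans hdoub).trans ?_
        gcongr
    _ = _ := by ring

/-- The lower bound: the gradient energy is controlled by the weak-type quantity. -/
theorem gradient_energy_le_weak (hn : 1 ≤ n) {p : ℝ} (hp : 1 ≤ p) {A : ℝ≥0}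
    {μ : Measure (EuclideanSpace ℝ (Fin n))} [SFinite μ] [NullSingletonClass μ] (hμ : BallAp p A μ)
    (hfin : ∀ x r, μ (Metric.ball x r) ≠ ∞) {f : EuclideanSpace ℝ (Fin n) → ℂ}
    (hf : Differentiable ℝ f) :
    ∫⁻ x, ENNReal.ofReal (gradNorm f x) ^ p ∂μ ≤
      ENNReal.ofReal (4 * √n) ^ p * (A * ENNReal.ofReal ((16 * √n) ^ n) ^ p) *
        ⨆ (t : ℝ) (_ : 0 < t), ENNReal.ofReal (t ^ p) * (μ.prod μ) (differenceSet p μ f t) := by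
  -- The pointwise bound needs balls of positive measure, which `BallAp.eq_zero` provides unless `μ
  -- = 0`.
  rcases eq_or_ne μ 0 with h0 | h0
  · simp [h0]
  have hp0 : 0 < p := by linarith
  set C := ENNReal.ofReal (4 * √n) ^ p * (A * ENNReal.ofReal ((16 * √n) ^ n) ^ p) with hC
  have hmeas : ∀ k : ℕ, MeasurableSet (differenceSet p μ f k) := fun k =>
    measurableSet_differenceSet p μ hf.continuous k
  calc _ ≤ ∫⁻ x, liminf (fun k : ℕ => C * (ENNReal.ofReal ((k : ℝ) ^ p) *
        μ (Prod.mk x ⁻¹' differenceSet p μ f k))) atTop ∂μ := by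
        refine lintegral_mono fun x => ?_
        exact le_liminf_of_le (by isBoundedDefault)
          (eventually_gradNorm_rpow_le hn hp hμ h0 hfin (hf x))
    _ ≤ liminf (fun k : ℕ => ∫⁻ x, C * (ENNReal.ofReal ((k : ℝ) ^ p) *
        μ (Prod.mk x ⁻¹' differenceSet p μ f k)) ∂μ) atTop :=
        lintegral_liminf_le fun k =>
          ((measurable_measure_prodMk_left (hmeas k)).const_mul _).const_mul _
    _ ≤ _ := by
        refine liminf_le_of_frequently_le' (Eventually.frequently ?_)
        filter_upwards [eventually_ge_atTop 1] with k hk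
        rw [lintegral_const_mul _ ((measurable_measure_prodMk_left (hmeas k)).const_mul _),
          lintegral_const_mul _ (measurable_measure_prodMk_left (hmeas k)),
          ← Measure.prod_apply (hmeas k)]
        gcongr
        exact le_iSup₂_of_le (k : ℝ) (by exact_mod_cast hk) le_rfl

end LowerBound

/-! ### From the measure back to the weight, and the conclusion. -/

lemma weakQuasinormPow_eq {n : ℕ} (p : ℝ) {ω : EuclideanSpace ℝ (Fin n) → ℝ}
    (hω : AEMeasurable (fun x => ENNReal.ofReal (ω x)) volume)
    {f : EuclideanSpace ℝ (Fin n) → ℂ} (hf : Continuous f)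
    {μ : Measure (EuclideanSpace ℝ (Fin n))}
    (hμ : μ = volume.withDensity fun x => ENNReal.ofReal (ω x)) :
    weakQuasinormPow p ω f =
      ⨆ (t : ℝ) (_ : 0 < t), ENNReal.ofReal (t ^ p) * (μ.prod μ) (differenceSet p μ f t) := by
  subst hμ
  set μ := volume.withDensity fun x => ENNReal.ofReal (ω x) with hμ
  unfold weakQuasinormPow
  congr! 4 with t ht
  have hD : superlevelSet p ω f t = differenceSet p μ f t := by
    ext z
    simp only [superlevelSet, differenceSet, weightOf, Set.mem_ofPred_eq, dist_eq_norm, ofReal_norm,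
      hμ, withDensity_apply _ measurableSet_ball]
  have hm := measurableSet_differenceSet p μ hf t
  -- Here `x` is the inner variable, hence Tonelli in the symmetric order.
  rw [hD, ← lintegral_indicator_one hm, lintegral_prod_symm _ (measurable_one.indicator hm).aemeasurable,
    hμ, lintegral_withDensity_eq_lintegral_mul₀ hω]
  · refine lintegral_congr fun y => ?_
    rw [Pi.mul_apply, lintegral_withDensity_eq_lintegral_mul₀ hω, mul_comm,
      ← lintegral_mul_const' _ _ ENNReal.ofReal_ne_top]
    · simp [mul_comm]
    · exact ((measurable_one.indicator hm).comp measurable_prodMk_right).aemeasurable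
  · exact ((measurable_one.indicator hm).lintegral_prod_left').aemeasurable

lemma sobolevPow_eq {n : ℕ} {p : ℝ} (hp : 0 ≤ p) {ω : EuclideanSpace ℝ (Fin n) → ℝ}
    (hω : AEMeasurable (fun x => ENNReal.ofReal (ω x)) volume)
    {f : EuclideanSpace ℝ (Fin n) → ℂ} (hf : ContDiff ℝ 1 f) :
    sobolevPow p ω f = ∫⁻ x, ENNReal.ofReal (gradNorm f x) ^ p
      ∂(volume.withDensity fun x => ENNReal.ofReal (ω x)) := by
  have hG := continuous_gradNorm hf
  rw [lintegral_withDensity_eq_lintegral_mul₀ hω (by fun_prop)]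
  refine lintegral_congr fun x => ?_
  rw [Pi.mul_apply, ENNReal.ofReal_mul (Real.rpow_nonneg (gradNorm_nonneg f x) p), mul_comm,
    ENNReal.ofReal_rpow_of_nonneg (gradNorm_nonneg f x) hp]

theorem theorem4p6 (n : ℕ) (hn : 1 ≤ n) (p : ℝ) (hp : 1 ≤ p) (K : ℝ≥0) :
    ∃ c C : ℝ≥0, 0 < c ∧ 0 < C ∧
      ∀ ω : EuclideanSpace ℝ (Fin n) → ℝ, IsApWeight p ω → apConst p ω ≤ K →
        ∀ f : EuclideanSpace ℝ (Fin n) → ℂ, ContDiff ℝ 2 f → HasCompactSupport f →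
          c * sobolevPow p ω f ≤ weakQuasinormPow p ω f ∧
            weakQuasinormPow p ω f ≤ C * sobolevPow p ω f := by
  obtain ⟨A, hA0, hA⟩ := exists_ballAp n hp K
  obtain ⟨C, hC⟩ := exists_weak_le_gradient_energy n hp A
  have hp0 : 0 < p := by linarith
  have hN0 : 0 < √(n : ℝ) := Real.sqrt_pos.2 (by exact_mod_cast hn)
  set B : ℝ≥0∞ := ENNReal.ofReal (4 * √n) ^ p * (A * ENNReal.ofReal ((16 * √n) ^ n) ^ p) with hB
  have hpow : ∀ a : ℝ, 0 < a → ENNReal.ofReal a ^ p ≠ 0 ∧ ENNReal.ofReal a ^ p ≠ ∞ := fun a ha =>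
    ⟨(ENNReal.rpow_pos (ENNReal.ofReal_pos.2 ha) ENNReal.ofReal_ne_top).ne',
      ENNReal.rpow_ne_top_of_nonneg hp0.le ENNReal.ofReal_ne_top⟩
  obtain ⟨h1, h1'⟩ := hpow (4 * √n) (by positivity)
  obtain ⟨h2, h2'⟩ := hpow ((16 * √n) ^ n) (by positivity)
  have hBt : B ≠ ∞ := by finiteness
  have hB0 : B ≠ 0 := mul_ne_zero h1 (mul_ne_zero (by exact_mod_cast hA0.ne') h2)
  have hBpos : 0 < B.toNNReal := ENNReal.toNNReal_pos hB0 hBt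
  -- `C` might be zero, hence `C + 1`.
  refine ⟨B.toNNReal⁻¹, C + 1, inv_pos.2 hBpos, by positivity, fun ω hω hK f hf _ => ?_⟩
  have hm : AEMeasurable (fun x => ENNReal.ofReal (ω x)) volume :=
    hω.locallyIntegrable.aestronglyMeasurable.aemeasurable.ennreal_ofReal
  have hf1 : ContDiff ℝ 1 f := hf.of_le (by norm_num)
  set μ := volume.withDensity fun x => ENNReal.ofReal (ω x) with hμ
  have hAμ : BallAp p A μ := hA ω hm hK
  have hfin : ∀ x r, μ (Metric.ball x r) ≠ ∞ := by
    intro x r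
    rw [hμ, withDensity_apply _ measurableSet_ball]
    exact ((hω.locallyIntegrable.integrableOn_isCompact (isCompact_closedBall x r)).mono_set
      Metric.ball_subset_closedBall).lintegral_lt_top.ne
  -- Points are null sets because the dimension is positive.
  have : Nonempty (Fin n) := ⟨⟨0, hn⟩⟩
  have : Nontrivial (EuclideanSpace ℝ (Fin n)) := inferInstance
  have : NullSingletonClass μ := ⟨fun x =>
    withDensity_absolutelyContinuous _ _ (measure_singleton x)⟩
  rw [sobolevPow_eq hp0.le hm hf1, weakQuasinormPow_eq p hm hf.continuous hμ, ← hμ]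
  constructor
  · rw [ENNReal.coe_inv hBpos.ne', ENNReal.coe_toNNReal hBt, mul_comm, ← div_eq_mul_inv]
    exact ENNReal.div_le_of_le_mul'
      (gradient_energy_le_weak hn hp hAμ hfin (hf1.differentiable one_ne_zero))
  · refine iSup₂_le fun t ht => (hC μ hAμ f hf1 t ht).trans ?_
    gcongr
    exact_mod_cast le_self_add
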